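/- Let $\mathsf{k}$ be a field, let $a$ and $r$ be relatively prime positive integers, and let $A=\mathsf{k}[[t^a,t^{a+r},t^{a+2r},t^{a+3r}]]\subseteq \mathsf{k}[[t]]$. Let $R=\mathsf{k}[[x,y,z,w]]$, and let $P$ be the defining ideal of $A$, that is, the kernel of the substitution homomorphism $R\to A$ with $x\mapsto t^a$, $y\mapsto t^{a+r}$, $z\mapsto t^{a+2r}$, $w\mapsto t^{a+3r}$. Let $k$ be a positive integer. Then $P$ is minimally generated by - the $4$ elements $z^2-yw,\ yz-xw,\ y^2-xz,\ x^{k+r}-w^k$, if $a=3k$; - the $6$ elements $z^2-yw,\ yz-xw,\ y^2-xz,\ x^{k+r}z-w^{k+1},\ x^{k+r}y-zw^k,\ x^{k+r+1}-yw^k$, if $a=3k+1$; - the $5$ elements $z^2-yw,\ yz-xw,\ y^2-xz,\ x^{k+r+1}-zw^k,\ x^{k+r}y-w^{k+1}$, if $a=3k+2$. Here "minimally generated by $n$ listed elements" means that these elements generate $P$, that none of them can be omitted, and that $P$ cannot be generated by fewer than $n$ elements. -/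

import Mathlib

/-- The family `t ^ e i` of powers of the variable of `𝕜[[t]]`, with all `e i` positive, may be
substituted into a power series in finitely many variables. -/
theorem hasSubst_X_pow (𝕜 : Type*) [Field 𝕜] {d : ℕ} (e : Fin d → ℕ) (he : ∀ i, 0 < e i) :
    MvPowerSeries.HasSubst (fun i => (PowerSeries.X : PowerSeries 𝕜) ^ e i) := by
  apply MvPowerSeries.hasSubst_of_constantCoeff_zero
  intro i
  change PowerSeries.constantCoeff ((PowerSeries.X : PowerSeries 𝕜) ^ e i) = 0
  rw [map_pow, PowerSeries.constantCoeff_X, zero_pow (he i).ne']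

/-- The homomorphism `𝕜[[x₁, …, x_d]] → 𝕜[[t]]` that substitutes `t ^ e i` for `x i`. -/
noncomputable def monomialCurveHom (𝕜 : Type*) [Field 𝕜] {d : ℕ} (e : Fin d → ℕ)
    (he : ∀ i, 0 < e i) : MvPowerSeries (Fin d) 𝕜 →ₐ[𝕜] PowerSeries 𝕜 :=
  MvPowerSeries.substAlgHom (hasSubst_X_pow 𝕜 e he)

/-- The monomial curve `A = 𝕜[[t ^ e 1, …, t ^ e d]] ⊆ 𝕜[[t]]`: all power series in the
`t ^ e i`. -/
noncomputable def monomialCurve (𝕜 : Type*) [Field 𝕜] {d : ℕ} (e : Fin d → ℕ)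
    (he : ∀ i, 0 < e i) : Subalgebra 𝕜 (PowerSeries 𝕜) :=
  (monomialCurveHom 𝕜 e he).range

/-- The surjection `𝕜[[x₁, …, x_d]] → 𝕜[[t ^ e 1, …, t ^ e d]]`, `x i ↦ t ^ e i`. -/
noncomputable def monomialCurvePresentation (𝕜 : Type*) [Field 𝕜] {d : ℕ} (e : Fin d → ℕ)
    (he : ∀ i, 0 < e i) : MvPowerSeries (Fin d) 𝕜 →ₐ[𝕜] monomialCurve 𝕜 e he :=
  (monomialCurveHom 𝕜 e he).rangeRestrict

/-- The defining ideal of the monomial curve: the kernel of its presentation. -/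
noncomputable def definingIdeal (𝕜 : Type*) [Field 𝕜] {d : ℕ} (e : Fin d → ℕ)
    (he : ∀ i, 0 < e i) : Ideal (MvPowerSeries (Fin d) 𝕜) :=
  RingHom.ker (monomialCurvePresentation 𝕜 e he)

/-- The exponents `a, a + r, a + 2r, a + 3r`. -/
def arithExponents (a r : ℕ) : Fin 4 → ℕ := ![a, a + r, a + 2 * r, a + 3 * r]

theorem arithExponents_pos {a : ℕ} (ha : 0 < a) (r : ℕ) (i : Fin 4) :
    0 < arithExponents a r i := by
  fin_cases i <;> simp [arithExponents] <;> omega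

/-- The ideal `I` is minimally generated by the `n` listed elements `g 0, …, g (n - 1)`: they
generate `I`, none of them is redundant, and `I` has no generating set with fewer than `n`
elements. -/
structure IsMinimallyGeneratedBy {R : Type*} [CommRing R] (I : Ideal R) {n : ℕ}
    (g : Fin n → R) : Prop where
  span_eq : Ideal.span (Set.range g) = I
  irredundant : ∀ i, Ideal.span (g '' {i}ᶜ) ≠ I
  card_le : ∀ s : Finset R, Ideal.span (s : Set R) = I → n ≤ s.card

/-!
Give the monomial `x ^ i y ^ b z ^ c w ^ d` the weight `a (i + b + c + d) + r (b + 2c + 3d)`, the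
exponent of its image in `𝕜[[t]]`. A power series lies in `P` if and only if, for each `N`, its
coefficients at the finitely many monomials of weight `N` add up to zero
(`coeff_monomialCurveHom`); its weighted components are then combinations of differences of
monomials of equal weight.

Let `J` be the ideal generated by the listed binomials, which are weighted homogeneous. Two facts
give `P ≤ J`.

* Monomials of equal weight are congruent modulo `J` (`monomial_sub_mem_of_weight_eq`). The
  binomials rewrite each monomial, without changing its weight, to a normal form with `b + c ≤ 1`
  and `b + 2c + 3d < a`. The weight modulo `a` determines `b + 2c + 3d`, because `a` and `r` are
  coprime, hence it determines `b`, `c` and `d`; then the weight itself determines `i`.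
* `J` contains a power series as soon as it contains all the weighted components
  (`mem_span_of_weighted_components`): the multipliers found in the single weights are glued,
  one coefficient at a time, to multipliers that are power series.

For minimality, each listed binomial contains a monomial that is divisible by no other monomial
occurring in the list. Taking the coefficients at these monomials gives a linear map that kills
`𝔪 P` and sends the binomials to a basis up to sign (`card_le_of_coeff_separating`), so no smaller
set generates `P`. Irredundancy follows.
-/

/-! ### Ideals generated by weighted homogeneous power series -/

open MvPowerSeries in
/-- An ideal of power series generated by finitely many weighted homogeneous elements is closed
for the weighted grading: it contains `f` as soon as it approximates each weighted component
of `f`. -/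
theorem mem_span_of_weighted_components {σ ι 𝕜 : Type*} [Field 𝕜] [Fintype ι]
    (wt : (σ →₀ ℕ) →+ ℕ) (g : ι → MvPowerSeries σ 𝕜) (deg : ι → ℕ)
    (hg : ∀ j b, coeff b (g j) ≠ 0 → wt b = deg j) (f : MvPowerSeries σ 𝕜)
    (h : ∀ N, ∃ p ∈ Ideal.span (Set.range g), ∀ n, wt n = N → coeff n p = coeff n f) :
    f ∈ Ideal.span (Set.range g) := by
  classical
  have h' : ∀ N, ∃ q : ι → MvPowerSeries σ 𝕜,
      ∀ n, wt n = N → coeff n (∑ j, q j * g j) = coeff n f := by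
    intro N
    obtain ⟨p, hp, hpf⟩ := h N
    obtain ⟨q, rfl⟩ := (Ideal.mem_span_range_iff_exists_fun).1 hp
    exact ⟨q, hpf⟩
  choose q hq using h'
  -- The coefficient at `m` of the `j`-th multiplier can only influence `f` in weight
  -- `wt m + deg j`, so it is read off from the representation chosen for that weight.
  let Q : ι → MvPowerSeries σ 𝕜 := fun j m => coeff m (q (wt m + deg j) j)
  have hQ : ∀ j m, coeff m (Q j) = coeff m (q (wt m + deg j) j) := fun _ _ => rfl
  refine (Ideal.mem_span_range_iff_exists_fun).2 ⟨Q, ?_⟩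
  ext n
  rw [← hq (wt n) n rfl, map_sum, map_sum]
  refine Finset.sum_congr rfl fun j _ => ?_
  rw [coeff_mul, coeff_mul]
  refine Finset.sum_congr rfl fun ab hab => ?_
  by_cases hb : coeff ab.2 (g j) = 0
  · simp [hb]
  · rw [hQ, ← hg j _ hb, ← map_add, Finset.HasAntidiagonal.mem_antidiagonal.1 hab]

/-! ### Lower bounds for the number of generators -/

open MvPowerSeries in
/-- If the exponents `δ i` are such that the coefficients at all proper divisors of `X ^ δ i`
vanish on the `g j`, and the coefficient at `X ^ δ i` vanishes on `g j` exactly when `j ≠ i`,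
then the coefficients at the `δ i` separate the classes of the `g j` modulo `𝔪 I`, so the ideal
`I` they generate needs that many generators. -/
theorem card_le_of_coeff_separating {σ 𝕜 : Type*} [Field 𝕜] {n : ℕ}
    (g : Fin n → MvPowerSeries σ 𝕜) (δ : Fin n → σ →₀ ℕ)
    (hlt : ∀ i j m, m < δ i → coeff m (g j) = 0)
    (hne : ∀ i j, i ≠ j → coeff (δ i) (g j) = 0) (hself : ∀ i, coeff (δ i) (g i) ≠ 0)
    (s : Finset (MvPowerSeries σ 𝕜))
    (hs : Ideal.span (s : Set (MvPowerSeries σ 𝕜)) = Ideal.span (Set.range g)) :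
    n ≤ s.card := by
  classical
  let φ : MvPowerSeries σ 𝕜 →ₗ[𝕜] (Fin n → 𝕜) := LinearMap.pi fun i => coeff (δ i)
  have hvan : ∀ p ∈ Ideal.span (Set.range g), ∀ i m, m < δ i → coeff m p = 0 := by
    intro p hp i
    induction hp using Submodule.span_induction with
    | mem x hx => obtain ⟨j, rfl⟩ := hx; exact fun m hm => hlt i j m hm
    | zero => simp
    | add x y _ _ hx hy => intro m hm; simp [hx m hm, hy m hm]
    | smul u x _ hx =>
      intro m hm
      rw [smul_eq_mul, coeff_mul]
      refine Finset.sum_eq_zero fun ab hab => ?_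
      have hle : ab.2 ≤ m := by
        rw [← Finset.HasAntidiagonal.mem_antidiagonal.1 hab]; exact le_add_self
      rw [hx _ (hle.trans_lt hm), mul_zero]
  have hmul : ∀ p ∈ Ideal.span (Set.range g), ∀ u, φ (u * p) = coeff 0 u • φ p := by
    intro p hp u
    ext i
    change coeff (δ i) (u * p) = coeff 0 u * coeff (δ i) p
    rw [coeff_mul]
    refine Finset.sum_eq_single (0, δ i) (fun ab hab hab0 => ?_) (fun h => ?_)
    · have hsum := Finset.HasAntidiagonal.mem_antidiagonal.1 hab
      have hle : ab.2 ≤ δ i := by rw [← hsum]; exact le_add_self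
      have hlt' : ab.2 < δ i := by
        refine lt_of_le_of_ne hle fun h => hab0 ?_
        rw [h] at hsum
        exact Prod.ext (by simpa using hsum) h
      rw [hvan p hp i _ hlt', mul_zero]
    · simp at h
  have hspan : ∀ p ∈ Ideal.span (s : Set (MvPowerSeries σ 𝕜)),
      φ p ∈ Submodule.span 𝕜 ((s.image φ : Finset (Fin n → 𝕜)) : Set (Fin n → 𝕜)) := by
    intro p hp
    induction hp using Submodule.span_induction with
    | mem x hx => exact Submodule.subset_span (by simpa using ⟨x, hx, rfl⟩)
    | zero => simp
    | add x y _ _ hx hy => rw [map_add]; exact add_mem hx hy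
    | smul u x hx' hx =>
      rw [smul_eq_mul, hmul x (hs ▸ hx')]
      exact Submodule.smul_mem _ _ hx
  have htop : Submodule.span 𝕜 ((s.image φ : Finset (Fin n → 𝕜)) : Set (Fin n → 𝕜)) = ⊤ := by
    rw [eq_top_iff, ← (Pi.basisFun 𝕜 (Fin n)).span_eq, Submodule.span_le]
    rintro _ ⟨i, rfl⟩
    have hi : φ (g i) = coeff (δ i) (g i) • Pi.basisFun 𝕜 (Fin n) i := by
      ext l
      change coeff (δ l) (g i) = _
      by_cases hl : l = i
      · subst hl; simp
      · simp [hne l i hl, hl]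
    have hmem := hspan (g i) (hs ▸ Ideal.subset_span ⟨i, rfl⟩)
    rw [hi] at hmem
    exact (Submodule.smul_mem_iff _ (hself i)).1 hmem
  have hfin := finrank_span_finset_le_card (R := 𝕜) (s.image φ)
  rw [Set.finrank, htop, finrank_top, Module.finrank_fin_fun] at hfin
  exact hfin.trans Finset.card_image_le

/-- No element of a generating family of the smallest possible size is redundant. -/
theorem IsMinimallyGeneratedBy.of_card_le {R : Type*} [CommRing R] {I : Ideal R} {n : ℕ}
    {g : Fin n → R} (hspan : Ideal.span (Set.range g) = I)
    (hcard : ∀ s : Finset R, Ideal.span (s : Set R) = I → n ≤ s.card) :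
    IsMinimallyGeneratedBy I g := by
  classical
  refine ⟨hspan, fun i hi => ?_, hcard⟩
  have h := hcard ((Finset.univ.erase i).image g) (by
    rw [← hi]; congr 1; ext; simp)
  have h' := h.trans Finset.card_image_le
  rw [Finset.card_erase_of_mem (Finset.mem_univ i), Finset.card_univ, Fintype.card_fin] at h'
  have := i.pos
  omega

/-! ### Binomial generators of the defining ideal of a monomial curve -/

section definingIdeal

open MvPowerSeries

variable {𝕜 : Type*} [Field 𝕜] {d : ℕ} {e : Fin d → ℕ} (he : ∀ i, 0 < e i)

theorem mem_definingIdeal {f : MvPowerSeries (Fin d) 𝕜} :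
    f ∈ definingIdeal 𝕜 e he ↔ monomialCurveHom 𝕜 e he f = 0 := by
  rw [definingIdeal, RingHom.mem_ker, ← Subtype.coe_inj]
  rfl

theorem monomialCurveHom_monomial (μ : Fin d →₀ ℕ) :
    monomialCurveHom 𝕜 e he (monomial μ 1) = PowerSeries.X ^ Finsupp.weight e μ := by
  rw [monomialCurveHom, substAlgHom_monomial, map_one, one_mul, Finsupp.weight_apply,
    Finsupp.prod, Finsupp.sum, ← Finset.prod_pow_eq_pow_sum]
  refine Finset.prod_congr rfl fun i _ => ?_
  rw [← pow_mul, smul_eq_mul, mul_comm]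

/-- The coefficient of `t ^ N` in the image of `f` is the sum of the coefficients of `f` at
monomials of weight `N`. -/
theorem coeff_monomialCurveHom (f : MvPowerSeries (Fin d) 𝕜) (N : ℕ) :
    PowerSeries.coeff N (monomialCurveHom 𝕜 e he f) =
      ∑ μ ∈ (Finsupp.finite_of_nat_weight_eq e (fun i => (he i).ne') N).toFinset,
        coeff μ f := by
  classical
  have hprod : ∀ μ : Fin d →₀ ℕ,
      (μ.prod fun i m => ((PowerSeries.X : PowerSeries 𝕜) ^ e i) ^ m) =
        PowerSeries.X ^ Finsupp.weight e μ := by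
    intro μ
    rw [← monomialCurveHom_monomial he, monomialCurveHom, substAlgHom_monomial, map_one, one_mul]
  have hterm : ∀ μ : Fin d →₀ ℕ, coeff μ f • PowerSeries.coeff N
      (μ.prod fun i m => ((PowerSeries.X : PowerSeries 𝕜) ^ e i) ^ m) =
        if Finsupp.weight e μ = N then coeff μ f else 0 := by
    intro μ
    rw [hprod, PowerSeries.coeff_X_pow]
    simp [eq_comm]
  have h : PowerSeries.coeff N (monomialCurveHom 𝕜 e he f) = finsum fun μ => coeff μ f •
      PowerSeries.coeff N (μ.prod fun i m => ((PowerSeries.X : PowerSeries 𝕜) ^ e i) ^ m) := by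
    rw [monomialCurveHom, substAlgHom_apply]
    exact coeff_subst (hasSubst_X_pow 𝕜 e he) f _
  rw [h, finsum_congr hterm, finsum_eq_sum_of_support_subset]
  · refine Finset.sum_congr rfl fun μ hμ => if_pos (by simpa using hμ)
  · intro μ hμ
    by_contra hN
    exact hμ (if_neg (by simpa using hN))

/-- The defining ideal is generated by given binomials as soon as these are weighted homogeneous
and identify all monomials of equal weight. It needs all of them if each contains a monomial
`X ^ δ i` divisible by none of the other monomials involved. -/
theorem isMinimallyGeneratedBy_definingIdeal {n : ℕ} (g : Fin n → MvPowerSeries (Fin d) 𝕜)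
    (δ η : Fin n → Fin d →₀ ℕ)
    (hg : ∀ i, g i = monomial (δ i) 1 - monomial (η i) 1 ∨
      g i = -(monomial (δ i) 1 - monomial (η i) 1))
    (hwt : ∀ i, Finsupp.weight e (δ i) = Finsupp.weight e (η i))
    (hδ : ∀ i j, δ j ≤ δ i → j = i) (hη : ∀ i j, ¬ η j ≤ δ i)
    (hcongr : ∀ μ ν : Fin d →₀ ℕ, Finsupp.weight e μ = Finsupp.weight e ν →
      monomial μ (1 : 𝕜) - monomial ν 1 ∈ Ideal.span (Set.range g)) :
    IsMinimallyGeneratedBy (definingIdeal 𝕜 e he) g := by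
  classical
  have hcoeff : ∀ i m, coeff m (g i) ≠ 0 → m = δ i ∨ m = η i := by
    intro i m hm
    by_contra! hcon
    apply hm
    rcases hg i with h | h <;> rw [h] <;>
      simp [coeff_monomial, hcon.1, hcon.2]
  have hspan : Ideal.span (Set.range g) = definingIdeal 𝕜 e he := by
    apply le_antisymm
    · rw [Ideal.span_le]
      rintro _ ⟨i, rfl⟩
      rw [SetLike.mem_coe, mem_definingIdeal]
      rcases hg i with h | h <;>
        simp [h, monomialCurveHom_monomial, hwt]
    · intro f hf
      refine mem_span_of_weighted_components (Finsupp.weight e) g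
        (fun i => Finsupp.weight e (δ i)) (fun i m hm => ?_) f (fun N => ?_)
      · rcases hcoeff i m hm with rfl | rfl
        · rfl
        · exact (hwt i).symm
      -- The component of `f` of weight `N` has coefficient sum `0`, so it is a combination of
      -- differences of monomials of weight `N`.
      set S := (Finsupp.finite_of_nat_weight_eq e (fun i => (he i).ne') N).toFinset with hS
      have hsum : ∑ μ ∈ S, coeff μ f = 0 := by
        rw [hS, ← coeff_monomialCurveHom he, (mem_definingIdeal he).1 hf, map_zero]
      refine ⟨∑ μ ∈ S, monomial μ (coeff μ f), ?_, fun m hm => ?_⟩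
      · rcases S.eq_empty_or_nonempty with hemp | ⟨ν, hν⟩
        · simp [hemp]
        · have heq : ∑ μ ∈ S, monomial μ (coeff μ f) =
              ∑ μ ∈ S, C (coeff μ f) * (monomial μ (1 : 𝕜) - monomial ν 1) := by
            simp_rw [mul_sub]
            rw [Finset.sum_sub_distrib, ← Finset.sum_mul, ← map_sum, hsum, map_zero, zero_mul,
              sub_zero]
            refine Finset.sum_congr rfl fun μ _ => ?_
            rw [← smul_eq_C_mul, ← map_smul, smul_eq_mul, mul_one]
          rw [heq]
          refine Ideal.sum_mem _ fun μ hμ => Ideal.mul_mem_left _ _ (hcongr _ _ ?_)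
          simp only [hS, Set.Finite.mem_toFinset, Set.mem_ofPred_eq] at hμ hν
          rw [hμ, hν]
      · have hmS : m ∈ S := by simpa [hS] using hm
        simp [map_sum, coeff_monomial, hmS]
  refine .of_card_le hspan fun s hs =>
    card_le_of_coeff_separating g δ ?_ ?_ ?_ s (hs.trans hspan.symm)
  · intro i j m hm
    by_contra hne
    rcases hcoeff j m hne with rfl | rfl
    · exact hm.ne (congrArg δ (hδ i j hm.le))
    · exact hη i j hm.le
  · intro i j hij
    by_contra hne
    rcases hcoeff j _ hne with h | h
    · exact hij (hδ i j h.ge).symm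
    · exact hη i j h.ge
  · intro i
    have hi : δ i ≠ η i := fun h => hη i i h.ge
    rcases hg i with h | h <;> simp [h, coeff_monomial, hi]

end definingIdeal

/-! ### Normal forms of monomials -/

section normalForm

variable {R : Type*} [CommRing R] {J : Ideal R} {x y z w : R} {a r : ℕ}

/-- If modulo `J` the quadrics of the twisted cubic vanish, and every monomial `x ^ i y ^ b z ^ c
w ^ d` with `b + c ≤ 1` and `a ≤ b + 2c + 3d` can be replaced by a smaller one of the same weight,
then every monomial is congruent to one of the same weight in normal form, that is, with
`b + c ≤ 1` and `b + 2c + 3d < a`. The size of a monomial is measured by `2b + 3c + 3d`, which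
drops under each of `z² ↦ yw`, `yz ↦ xw` and `y² ↦ xz`. -/
theorem exists_normalForm (hz : z ^ 2 - y * w ∈ J) (hyz : y * z - x * w ∈ J)
    (hy : y ^ 2 - x * z ∈ J)
    (hstep : ∀ i b c d, b + c ≤ 1 → a ≤ b + 2 * c + 3 * d → ∃ i' b' c' d',
      2 * b' + 3 * c' + 3 * d' < 2 * b + 3 * c + 3 * d ∧
      a * (i + b + c + d) + r * (b + 2 * c + 3 * d) =
        a * (i' + b' + c' + d') + r * (b' + 2 * c' + 3 * d') ∧
      x ^ i * y ^ b * z ^ c * w ^ d - x ^ i' * y ^ b' * z ^ c' * w ^ d' ∈ J)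
    (i b c d : ℕ) :
    ∃ i' b' c' d', b' + c' ≤ 1 ∧ b' + 2 * c' + 3 * d' < a ∧
      a * (i + b + c + d) + r * (b + 2 * c + 3 * d) =
        a * (i' + b' + c' + d') + r * (b' + 2 * c' + 3 * d') ∧
      x ^ i * y ^ b * z ^ c * w ^ d - x ^ i' * y ^ b' * z ^ c' * w ^ d' ∈ J := by
  induction hM : 2 * b + 3 * c + 3 * d using Nat.strong_induction_on generalizing i b c d with
  | _ M ih =>
  subst hM
  suffices h : (b + c ≤ 1 ∧ b + 2 * c + 3 * d < a) ∨ ∃ i' b' c' d',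
      2 * b' + 3 * c' + 3 * d' < 2 * b + 3 * c + 3 * d ∧
      a * (i + b + c + d) + r * (b + 2 * c + 3 * d) =
        a * (i' + b' + c' + d') + r * (b' + 2 * c' + 3 * d') ∧
      x ^ i * y ^ b * z ^ c * w ^ d - x ^ i' * y ^ b' * z ^ c' * w ^ d' ∈ J by
    rcases h with h | ⟨i₁, b₁, c₁, d₁, hlt, hwt, hJ⟩
    · exact ⟨i, b, c, d, h.1, h.2, rfl, by simp⟩
    · obtain ⟨i₂, b₂, c₂, d₂, h1, h2, hwt', hJ'⟩ := ih _ hlt i₁ b₁ c₁ d₁ rfl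
      exact ⟨i₂, b₂, c₂, d₂, h1, h2, hwt.trans hwt', by simpa using J.add_mem hJ hJ'⟩
  by_cases hbc : b + c ≤ 1
  · by_cases hs : b + 2 * c + 3 * d < a
    · exact .inl ⟨hbc, hs⟩
    · exact .inr (hstep i b c d hbc (not_lt.1 hs))
  refine .inr ?_
  rcases Nat.lt_or_ge 1 b with hb | hb
  · obtain ⟨b, rfl⟩ := Nat.exists_eq_add_of_lt hb
    refine ⟨i + 1, b, c + 1, d, by omega, by ring, ?_⟩
    convert J.mul_mem_left (x ^ i * y ^ b * z ^ c * w ^ d) hy using 1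
    ring
  rcases Nat.lt_or_ge 1 c with hc | hc
  · obtain ⟨c, rfl⟩ := Nat.exists_eq_add_of_lt hc
    refine ⟨i, b + 1, c, d + 1, by omega, by ring, ?_⟩
    convert J.mul_mem_left (x ^ i * y ^ b * z ^ c * w ^ d) hz using 1
    ring
  · obtain ⟨rfl, rfl⟩ : b = 1 ∧ c = 1 := by omega
    refine ⟨i + 1, 0, 0, d + 1, by omega, by ring, ?_⟩
    convert J.mul_mem_left (x ^ i * w ^ d) hyz using 1
    ring

/-- For coprime `a` and `r`, a monomial in normal form is determined by its weight: the weight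
modulo `a` determines `b + 2c + 3d < a`. -/
theorem normalForm_unique (har : Nat.Coprime a r) {i b c d i' b' c' d' : ℕ}
    (h1 : b + c ≤ 1) (h2 : b + 2 * c + 3 * d < a) (h1' : b' + c' ≤ 1)
    (h2' : b' + 2 * c' + 3 * d' < a)
    (hwt : a * (i + b + c + d) + r * (b + 2 * c + 3 * d) =
      a * (i' + b' + c' + d') + r * (b' + 2 * c' + 3 * d')) :
    i = i' ∧ b = b' ∧ c = c' ∧ d = d' := by
  have hmod : r * (b + 2 * c + 3 * d) ≡ r * (b' + 2 * c' + 3 * d') [MOD a] := by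
    have h := congrArg (· % a) hwt
    simpa [Nat.ModEq] using h
  have hs : b + 2 * c + 3 * d = b' + 2 * c' + 3 * d' :=
    Nat.ModEq.eq_of_lt_of_lt (Nat.ModEq.cancel_left_of_coprime har hmod) h2 h2'
  rw [hs] at hwt
  have hi := Nat.eq_of_mul_eq_mul_left (by omega) (Nat.add_right_cancel hwt)
  omega

/-- Congruent to the same normal form, monomials of equal weight are congruent modulo `J`. -/
theorem monomial_sub_mem_of_weight_eq (har : Nat.Coprime a r)
    (hz : z ^ 2 - y * w ∈ J) (hyz : y * z - x * w ∈ J) (hy : y ^ 2 - x * z ∈ J)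
    (hstep : ∀ i b c d, b + c ≤ 1 → a ≤ b + 2 * c + 3 * d → ∃ i' b' c' d',
      2 * b' + 3 * c' + 3 * d' < 2 * b + 3 * c + 3 * d ∧
      a * (i + b + c + d) + r * (b + 2 * c + 3 * d) =
        a * (i' + b' + c' + d') + r * (b' + 2 * c' + 3 * d') ∧
      x ^ i * y ^ b * z ^ c * w ^ d - x ^ i' * y ^ b' * z ^ c' * w ^ d' ∈ J)
    {i b c d i' b' c' d' : ℕ}
    (hwt : a * (i + b + c + d) + r * (b + 2 * c + 3 * d) =
      a * (i' + b' + c' + d') + r * (b' + 2 * c' + 3 * d')) :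
    x ^ i * y ^ b * z ^ c * w ^ d - x ^ i' * y ^ b' * z ^ c' * w ^ d' ∈ J := by
  obtain ⟨i₁, b₁, c₁, d₁, h1, h2, h3, h4⟩ := exists_normalForm hz hyz hy hstep i b c d
  obtain ⟨i₂, b₂, c₂, d₂, h1', h2', h3', h4'⟩ := exists_normalForm hz hyz hy hstep i' b' c' d'
  obtain ⟨rfl, rfl, rfl, rfl⟩ := normalForm_unique har h1 h2 h1' h2' (h3.symm.trans (hwt.trans h3'))
  simpa using J.sub_mem h4 h4'

end normalForm

/-! ### Monomials in four variables -/

section exponents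

open MvPowerSeries

/-- The exponent vector of the monomial `x ^ i y ^ b z ^ c w ^ d`. -/
noncomputable def exponentVector (i b c d : ℕ) : Fin 4 →₀ ℕ :=
  Finsupp.equivFunOnFinite.symm ![i, b, c, d]

theorem exponentVector_le {i b c d i' b' c' d' : ℕ} :
    exponentVector i b c d ≤ exponentVector i' b' c' d' ↔ i ≤ i' ∧ b ≤ b' ∧ c ≤ c' ∧ d ≤ d' := by
  rw [← Finsupp.coe_le_coe, Pi.le_def]
  simp [exponentVector, Fin.forall_fin_succ]

theorem eq_exponentVector (μ : Fin 4 →₀ ℕ) : μ = exponentVector (μ 0) (μ 1) (μ 2) (μ 3) := by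
  ext i
  fin_cases i <;> simp [exponentVector]

theorem weight_exponentVector (a r i b c d : ℕ) :
    Finsupp.weight (arithExponents a r) (exponentVector i b c d) =
      a * (i + b + c + d) + r * (b + 2 * c + 3 * d) := by
  rw [Finsupp.weight_eq_sum, Fin.sum_univ_four]
  simp [exponentVector, arithExponents]
  ring

theorem monomial_exponentVector (𝕜 : Type*) [Field 𝕜] (i b c d : ℕ) :
    monomial (exponentVector i b c d) (1 : 𝕜) = X 0 ^ i * X 1 ^ b * X 2 ^ c * X 3 ^ d := by
  have h : exponentVector i b c d = Finsupp.single 0 i + Finsupp.single 1 b +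
      Finsupp.single 2 c + Finsupp.single 3 d := by
    ext j
    fin_cases j <;> simp [exponentVector]
  simp_rw [X_pow_eq, monomial_mul_monomial, mul_one, h]

end exponents

open MvPowerSeries in
/-- The criterion of `isMinimallyGeneratedBy_definingIdeal` for binomials in four variables that
include the quadrics of the twisted cubic, with the identification of monomials of equal weight
reduced to the single rewriting steps `hstep`. -/
theorem isMinimallyGeneratedBy_arithmetic {𝕜 : Type*} [Field 𝕜] {a r : ℕ} (ha : 0 < a)
    (har : Nat.Coprime a r) {n : ℕ} (g : Fin n → MvPowerSeries (Fin 4) 𝕜)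
    (δ η : Fin n → Fin 4 →₀ ℕ)
    (hg : ∀ i, g i = monomial (δ i) 1 - monomial (η i) 1 ∨
      g i = -(monomial (δ i) 1 - monomial (η i) 1))
    (hwt : ∀ i, Finsupp.weight (arithExponents a r) (δ i) =
      Finsupp.weight (arithExponents a r) (η i))
    (hδ : ∀ i j, δ j ≤ δ i → j = i) (hη : ∀ i j, ¬ η j ≤ δ i)
    (hz : X 2 ^ 2 - X 1 * X 3 ∈ Set.range g) (hyz : X 1 * X 2 - X 0 * X 3 ∈ Set.range g)
    (hy : X 1 ^ 2 - X 0 * X 2 ∈ Set.range g)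
    (hstep : ∀ i b c d, b + c ≤ 1 → a ≤ b + 2 * c + 3 * d → ∃ i' b' c' d',
      2 * b' + 3 * c' + 3 * d' < 2 * b + 3 * c + 3 * d ∧
      a * (i + b + c + d) + r * (b + 2 * c + 3 * d) =
        a * (i' + b' + c' + d') + r * (b' + 2 * c' + 3 * d') ∧
      (X 0 ^ i * X 1 ^ b * X 2 ^ c * X 3 ^ d - X 0 ^ i' * X 1 ^ b' * X 2 ^ c' * X 3 ^ d' :
        MvPowerSeries (Fin 4) 𝕜) ∈ Ideal.span (Set.range g)) :
    IsMinimallyGeneratedBy (definingIdeal 𝕜 (arithExponents a r) (arithExponents_pos ha r)) g := by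
  refine isMinimallyGeneratedBy_definingIdeal _ g δ η hg hwt hδ hη fun μ ν h => ?_
  rw [eq_exponentVector μ, eq_exponentVector ν, weight_exponentVector, weight_exponentVector] at h
  rw [eq_exponentVector μ, eq_exponentVector ν, monomial_exponentVector, monomial_exponentVector]
  exact monomial_sub_mem_of_weight_eq har (Ideal.subset_span hz) (Ideal.subset_span hyz)
    (Ideal.subset_span hy) hstep h

/-! ### The three residues of `a` modulo `3` -/

theorem mem_span_range_of_eq_mul {R ι : Type*} [CommRing R] {g : ι → R} {p : R} (j : ι) (u : R)
    (h : p = u * g j) : p ∈ Ideal.span (Set.range g) :=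
  h ▸ Ideal.mul_mem_left _ u (Ideal.subset_span (Set.mem_range_self j))

open MvPowerSeries in
theorem mainTheorem4 (𝕜 : Type*) [Field 𝕜] (a r k : ℕ) (ha : 0 < a) (hr : 0 < r) (hk : 0 < k)
    (har : Nat.Coprime a r)
    (x y z w : MvPowerSeries (Fin 4) 𝕜)
    (hx : x = MvPowerSeries.X 0) (hy : y = MvPowerSeries.X 1)
    (hz : z = MvPowerSeries.X 2) (hw : w = MvPowerSeries.X 3)
    (P : Ideal (MvPowerSeries (Fin 4) 𝕜))
    (hP : P = definingIdeal 𝕜 (arithExponents a r) (arithExponents_pos ha r)) :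
    (a = 3 * k → IsMinimallyGeneratedBy P
      ![z ^ 2 - y * w, y * z - x * w, y ^ 2 - x * z, x ^ (k + r) - w ^ k]) ∧
    (a = 3 * k + 1 → IsMinimallyGeneratedBy P
      ![z ^ 2 - y * w, y * z - x * w, y ^ 2 - x * z, x ^ (k + r) * z - w ^ (k + 1),
        x ^ (k + r) * y - z * w ^ k, x ^ (k + r + 1) - y * w ^ k]) ∧
    (a = 3 * k + 2 → IsMinimallyGeneratedBy P
      ![z ^ 2 - y * w, y * z - x * w, y ^ 2 - x * z, x ^ (k + r + 1) - z * w ^ k,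
        x ^ (k + r) * y - w ^ (k + 1)]) := by
  subst hx hy hz hw hP
  refine ⟨fun hak => ?_, fun hak => ?_, fun hak => ?_⟩
  · subst hak
    refine isMinimallyGeneratedBy_arithmetic ha har _
      ![exponentVector 0 0 2 0, exponentVector 0 1 1 0, exponentVector 0 2 0 0,
        exponentVector 0 0 0 k]
      ![exponentVector 0 1 0 1, exponentVector 1 0 0 1, exponentVector 1 0 1 0,
        exponentVector (k + r) 0 0 0] ?_ ?_ ?_ ?_ ⟨0, rfl⟩ ⟨1, rfl⟩ ⟨2, rfl⟩ ?_
    · simp [Fin.forall_fin_succ, monomial_exponentVector]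
    · simp only [Fin.forall_fin_succ, Matrix.cons_val_zero, Matrix.cons_val_succ,
        weight_exponentVector, IsEmpty.forall_iff, and_true, true_and]
      ring
    · simp [Fin.forall_fin_succ, exponentVector_le]
      omega
    · simp [Fin.forall_fin_succ, exponentVector_le]
      omega
    · intro i b c d hbc hs
      -- `w ^ k ↦ x ^ (k + r)`
      obtain ⟨d, rfl⟩ := Nat.exists_eq_add_of_le (show k ≤ d by omega)
      refine ⟨i + (k + r), b, c, d, by omega, by ring, ?_⟩
      refine mem_span_range_of_eq_mul 3 (-(X 0 ^ i * X 1 ^ b * X 2 ^ c * X 3 ^ d)) ?_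
      simp only [Matrix.cons_val]
      ring
  · subst hak
    -- The last binomial is represented by `x ^ (k + r + 1)`, because `y * w` divides `y * w ^ k`.
    refine isMinimallyGeneratedBy_arithmetic ha har _
      ![exponentVector 0 0 2 0, exponentVector 0 1 1 0, exponentVector 0 2 0 0,
        exponentVector 0 0 0 (k + 1), exponentVector (k + r) 1 0 0,
        exponentVector (k + r + 1) 0 0 0]
      ![exponentVector 0 1 0 1, exponentVector 1 0 0 1, exponentVector 1 0 1 0,
        exponentVector (k + r) 0 1 0, exponentVector 0 0 1 k,
        exponentVector 0 1 0 k] ?_ ?_ ?_ ?_ ⟨0, rfl⟩ ⟨1, rfl⟩ ⟨2, rfl⟩ ?_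
    · simp [Fin.forall_fin_succ, monomial_exponentVector]
    · simp only [Fin.forall_fin_succ, Matrix.cons_val_zero, Matrix.cons_val_succ,
        weight_exponentVector, IsEmpty.forall_iff, and_true, true_and]
      refine ⟨?_, ?_, ?_⟩ <;> ring
    · simp [Fin.forall_fin_succ, exponentVector_le]
      omega
    · simp [Fin.forall_fin_succ, exponentVector_le]
      omega
    · intro i b c d hbc hs
      -- `w ^ (k + 1) ↦ x ^ (k + r) z`, `y w ^ k ↦ x ^ (k + r + 1)`, `z w ^ k ↦ x ^ (k + r) y`
      rcases Nat.lt_or_ge k d with hd | hd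
      · obtain ⟨d, rfl⟩ := Nat.exists_eq_add_of_lt hd
        refine ⟨i + (k + r), b, c + 1, d, by omega, by ring, ?_⟩
        refine mem_span_range_of_eq_mul 3 (-(X 0 ^ i * X 1 ^ b * X 2 ^ c * X 3 ^ d)) ?_
        simp only [Matrix.cons_val]
        ring
      obtain ⟨rfl, rfl, rfl⟩ | ⟨rfl, rfl, rfl⟩ :
          (b = 1 ∧ c = 0 ∧ d = k) ∨ (b = 0 ∧ c = 1 ∧ d = k) := by omega
      · refine ⟨i + (d + r + 1), 0, 0, 0, by omega, by ring, ?_⟩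
        refine mem_span_range_of_eq_mul 5 (-X 0 ^ i) ?_
        simp only [Matrix.cons_val]
        ring
      · refine ⟨i + (d + r), 1, 0, 0, by omega, by ring, ?_⟩
        refine mem_span_range_of_eq_mul 4 (-X 0 ^ i) ?_
        simp only [Matrix.cons_val]
        ring
  · subst hak
    refine isMinimallyGeneratedBy_arithmetic ha har _
      ![exponentVector 0 0 2 0, exponentVector 0 1 1 0, exponentVector 0 2 0 0,
        exponentVector (k + r + 1) 0 0 0, exponentVector 0 0 0 (k + 1)]
      ![exponentVector 0 1 0 1, exponentVector 1 0 0 1, exponentVector 1 0 1 0,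
        exponentVector 0 0 1 k, exponentVector (k + r) 1 0 0]
      ?_ ?_ ?_ ?_ ⟨0, rfl⟩ ⟨1, rfl⟩ ⟨2, rfl⟩ ?_
    · simp [Fin.forall_fin_succ, monomial_exponentVector]
    · simp only [Fin.forall_fin_succ, Matrix.cons_val_zero, Matrix.cons_val_succ,
        weight_exponentVector, IsEmpty.forall_iff, and_true, true_and]
      refine ⟨?_, ?_⟩ <;> ring
    · simp [Fin.forall_fin_succ, exponentVector_le]
    · simp [Fin.forall_fin_succ, exponentVector_le]
      omega
    · intro i b c d hbc hs
      -- `w ^ (k + 1) ↦ x ^ (k + r) y`, `z w ^ k ↦ x ^ (k + r + 1)`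
      rcases Nat.lt_or_ge k d with hd | hd
      · obtain ⟨d, rfl⟩ := Nat.exists_eq_add_of_lt hd
        refine ⟨i + (k + r), b + 1, c, d, by omega, by ring, ?_⟩
        refine mem_span_range_of_eq_mul 4 (-(X 0 ^ i * X 1 ^ b * X 2 ^ c * X 3 ^ d)) ?_
        simp only [Matrix.cons_val]
        ring
      obtain ⟨rfl, rfl, rfl⟩ : b = 0 ∧ c = 1 ∧ d = k := by omega
      refine ⟨i + (d + r + 1), 0, 0, 0, by omega, by ring, ?_⟩
      refine mem_span_range_of_eq_mul 3 (-X 0 ^ i) ?_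
      simp only [Matrix.cons_val]
      ring
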